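/- Let $A$ be an artin algebra (an algebra that is finitely generated as a module over a commutative artinian ring). For integers $a\le b$ let $\mathbf{C}_{[a,b]}(\mathrm{proj}\,A)$ be the full subcategory of the category of cochain complexes of $A$-modules whose objects are the complexes $X=(X^i,d_X^i)_{i\in\mathbb Z}$ with all $X^i$ finitely generated projective and $X^i=0$ for $i\notin\{a,\dots,b\}$, with the exact structure given by the short exact sequences of complexes (equivalently, the sequences that are split exact in each degree). Write $\mathbf{C}_n(\mathrm{proj}\,A)=\mathbf{C}_{[1,n]}(\mathrm{proj}\,A)\subseteq \mathbf{C}_{[0,n]}(\mathrm{proj}\,A)$. Let $n\ge 1$, let $X$ be an indecomposable complex in $\mathbf{C}_n(\mathrm{proj}\,A)$, and let $P_S$ be the projective cover of the socle $\mathrm{soc}(\mathrm{Ker}\,d_X^1)$ of the kernel of $d_X^1:X^1\to X^2$. 1. If $f:X\to Z$ is a left almost split morphism in $\mathbf{C}_{[0,n]}(\mathrm{proj}\,A)$ (that is, $f$ is not a section and every morphism of $\mathbf{C}_{[0,n]}(\mathrm{proj}\,A)$ starting at $X$ that is not a section factors through $f$), then every indecomposable direct summand of $P_S$ is isomorphic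 to a direct summand of $Z^0$. 2. If $X$ is not injective in the exact category $\mathbf{C}_{[0,n]}(\mathrm{proj}\,A)$, then $(\tau^{-1}X)^0\in\mathrm{add}(P_S)$. Here $\tau^{-1}X$ is the inverse Auslander–Reiten translate of $X$ in $\mathbf{C}_{[0,n]}(\mathrm{proj}\,A)$, i.e. the last term of an almost split sequence $0\to X\to E\to\tau^{-1}X\to 0$ (a short exact sequence in the exact structure whose first map is left almost split and whose second map is right almost split), and $\mathrm{add}(P_S)$ is the class of modules isomorphic to finite direct sums of direct summands of $P_S$. -/

import Mathlib

open CategoryTheory CategoryTheory.Limits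

universe u v w

/-! ### Finitely generated projective modules and complexes of them -/

section Complexes

variable (A : Type u) [Ring A]

/-- `C_[a,b](proj A)` as a property of complexes: every term is a finitely generated projective
module, and the terms in degrees outside `{a, …, b}` vanish. -/
def IsBoundedProj (a b : ℤ) : ObjectProperty (CochainComplex (ModuleCat.{u} A) ℤ) := fun X =>
  (∀ i : ℤ, Module.Finite A (X.X i) ∧ Module.Projective A (X.X i)) ∧
    ∀ i : ℤ, i ∉ Set.Icc a b → IsZero (X.X i)

theorem IsBoundedProj.mono {a b a' b' : ℤ} (ha : a' ≤ a) (hb : b ≤ b') :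
    IsBoundedProj A a b ≤ IsBoundedProj A a' b' :=
  fun _ hX => ⟨hX.1, fun i hi => hX.2 i fun h => hi ⟨ha.trans h.1, h.2.trans hb⟩⟩

/-- The category `C_[a,b](proj A)`: a full subcategory of the category of complexes. -/
abbrev BoundedProjComplex (a b : ℤ) : Type (u + 1) := (IsBoundedProj A a b).FullSubcategory

/-- The inclusion of `C_n(proj A) = C_[1,n](proj A)` into `C_[0,n](proj A)`. -/
abbrev inclZero (n : ℕ) : BoundedProjComplex A 1 n ⥤ BoundedProjComplex A 0 n :=
  ObjectProperty.ιOfLE (IsBoundedProj.mono A zero_le_one le_rfl)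

instance (a b : ℤ) : (IsBoundedProj A a b).IsClosedUnderBinaryProducts where
  limitsOfShape_le := by
    rintro Y ⟨p⟩
    let X₁ := p.diag.obj ⟨WalkingPair.left⟩
    let X₂ := p.diag.obj ⟨WalkingPair.right⟩
    have h₁ : IsBoundedProj A a b X₁ := p.prop_diag_obj _
    have h₂ : IsBoundedProj A a b X₂ := p.prop_diag_obj _
    let e : Y ≅ X₁ ⊞ X₂ :=
      IsLimit.conePointsIsoOfNatIso p.isLimit (BinaryBiproduct.isLimit X₁ X₂)
        (diagramIsoPair p.diag)
    let ei (i : ℤ) : Y.X i ≅ ModuleCat.of A (X₁.X i × X₂.X i) :=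
      (HomologicalComplex.eval _ _ i).mapIso e ≪≫ HomologicalComplex.biprodXIso X₁ X₂ i ≪≫
        ModuleCat.biprodIsoProd _ _
    refine ⟨fun i => ?_, fun i hi => ?_⟩
    · have := (h₁.1 i).1
      have := (h₁.1 i).2
      have := (h₂.1 i).1
      have := (h₂.1 i).2
      exact ⟨Module.Finite.equiv (ei i).toLinearEquiv.symm,
        Module.Projective.of_equiv (ei i).toLinearEquiv.symm⟩
    · have := ModuleCat.subsingleton_of_isZero (h₁.2 i hi)
      have := ModuleCat.subsingleton_of_isZero (h₂.2 i hi)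
      exact (ModuleCat.isZero_of_subsingleton (ModuleCat.of A (X₁.X i × X₂.X i))).of_iso (ei i)

instance (a b : ℤ) : HasBinaryBiproducts (BoundedProjComplex A a b) :=
  HasBinaryBiproducts.of_hasBinaryProducts

end Complexes

/-! ### Almost split morphisms -/

section AlmostSplit

variable {C : Type v} [Category.{w} C]

/-- `f : X ⟶ Z` is left almost split: it is not a section, and every morphism starting at `X`
that is not a section factors through `f`. -/
def IsLeftAlmostSplit {X Z : C} (f : X ⟶ Z) : Prop :=
  ¬ IsSplitMono f ∧ ∀ ⦃W : C⦄ (g : X ⟶ W), ¬ IsSplitMono g → ∃ h : Z ⟶ W, f ≫ h = g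

/-- `g : Z ⟶ Y` is right almost split: it is not a retraction, and every morphism ending at `Y`
that is not a retraction factors through `g`. -/
def IsRightAlmostSplit {Z Y : C} (g : Z ⟶ Y) : Prop :=
  ¬ IsSplitEpi g ∧ ∀ ⦃W : C⦄ (k : W ⟶ Y), ¬ IsSplitEpi k → ∃ h : W ⟶ Z, h ≫ g = k

end AlmostSplit

/-! ### The exact structure of `C_[a,b](proj A)` -/

section Exact

variable {A : Type u} [Ring A] {a b : ℤ}

/-- The conflations of the exact category `C_[a,b](proj A)`: the sequences `X ⟶ E ⟶ Y` that are
short exact as sequences of complexes of modules (equivalently, split exact in each degree,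
because the terms of `Y` are projective). -/
def IsConflation (S : ShortComplex (BoundedProjComplex A a b)) : Prop :=
  (S.map (IsBoundedProj A a b).ι).ShortExact

/-- Injective objects of the exact category `C_[a,b](proj A)`. -/
def IsInjectiveComplex (I : BoundedProjComplex A a b) : Prop :=
  ∀ S : ShortComplex (BoundedProjComplex A a b), IsConflation S →
    ∀ g : S.X₁ ⟶ I, ∃ h : S.X₂ ⟶ I, S.f ≫ h = g

/-- Almost split sequences of the exact category `C_[a,b](proj A)`. -/
structure IsAlmostSplitSequence (S : ShortComplex (BoundedProjComplex A a b)) : Prop where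
  conflation : IsConflation S
  left : IsLeftAlmostSplit S.f
  right : IsRightAlmostSplit S.g

/-- `Y` is `τ⁻¹ X`, the inverse Auslander–Reiten translate of `X` in `C_[a,b](proj A)`: it is the
last term of an almost split sequence `0 ⟶ X ⟶ E ⟶ Y ⟶ 0`. -/
def IsInverseTranslate (X Y : BoundedProjComplex A a b) : Prop :=
  ∃ (E : BoundedProjComplex A a b) (f : X ⟶ E) (g : E ⟶ Y) (hfg : f ≫ g = 0),
    IsAlmostSplitSequence (ShortComplex.mk f g hfg)

end Exact

/-! ### Socles, projective covers, `add` -/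

section Modules

variable {A : Type u} [Ring A]

/-- The socle of a module: the sum of its simple submodules. -/
def moduleSocle (A : Type u) [Ring A] (M : Type u) [AddCommGroup M] [Module A M] :
    Submodule A M :=
  sSup {N : Submodule A M | IsSimpleModule A N}

/-- `p : P → M` is a projective cover: `P` is projective, `p` is surjective and its kernel is
superfluous. -/
structure IsProjectiveCover {P M : ModuleCat.{u} A} (p : P ⟶ M) : Prop where
  projective : Module.Projective A P
  surjective : Function.Surjective p
  superfluous : ∀ N : Submodule A P, N ⊔ LinearMap.ker p.hom = ⊤ → N = ⊤

/-- `Q` is isomorphic to a direct summand of `P`. -/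
def IsDirectSummand (Q P : ModuleCat.{u} A) : Prop := Nonempty (Retract Q P)

/-- `M` is in `add P`: it is isomorphic to a finite direct sum of direct summands of `P`. -/
def InAdd (P M : ModuleCat.{u} A) : Prop :=
  ∃ (k : ℕ) (Q : Fin k → ModuleCat.{u} A),
    (∀ j, IsDirectSummand (Q j) P) ∧ Nonempty (M ≅ ⨁ Q)

end Modules

/-- The module `soc (Ker d_X^1)`, where `d_X^1 : X^1 ⟶ X^2`. -/
abbrev socKerOne {A : Type u} [Ring A] {a b : ℤ} (X : BoundedProjComplex A a b) :
    ModuleCat.{u} A :=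
  ModuleCat.of A (moduleSocle A (LinearMap.ker (X.obj.d 1 2).hom))

/-! ### Socles, Fitting's lemma, projective covers and `add`. -/

section Modules

variable {A : Type u} [Ring A]

/-! Both parts test the almost split property on complexes obtained by changing only the term in
degree 0, using that `X⁰ = 0`. For part 1, a summand `Q` of `P_S` maps nontrivially to a simple
submodule of `Ker d¹`, giving `q : Q ⟶ X¹`. The inclusion of `X` into `Q ⟶ X¹ ⟶ X² ⟶ ⋯` is not a
section, so it factors through `f`. The factor `h` must satisfy `h⁰ ≫ q ≠ 0`, since otherwise its
positive components would retract `f` (`IsLeftAlmostSplit.exists_comp_ne_zero`). For part 2, replace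
`Y⁰` by a free cover of a proper submodule `N`. Lifting the resulting map to `E` splits the sequence
in positive degrees, and the obstruction to splitting `f` is a nonzero map `Y⁰ ⟶ Ker d¹` killing `N`
(`IsAlmostSplitSequence.exists_ne_zero_comp_eq_zero`). For maximal `N` this embeds `Y⁰/N` in the
socle. In both cases two projectives map onto a common simple module, and Fitting's lemma makes the
indecomposable one a summand of the other (`Indecomposable.isDirectSummand`). -/

instance isSemisimpleModule_moduleSocle (M : Type u) [AddCommGroup M] [Module A M] :
    IsSemisimpleModule A (moduleSocle A M) := by
  unfold moduleSocle
  rw [sSup_eq_iSup]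
  exact isSemisimpleModule_biSup_of_isSemisimpleModule_submodule (p := fun N => N)
    fun N (hN : IsSimpleModule A N) => inferInstance

/-- Every simple submodule lies in the socle. -/
theorem range_le_moduleSocle {S M : Type u} [AddCommGroup S] [Module A S] [AddCommGroup M]
    [Module A M] [IsSimpleModule A S] (θ : S →ₗ[A] M) : LinearMap.range θ ≤ moduleSocle A M := by
  rcases θ.injective_or_eq_zero with h | h
  · exact le_sSup (IsSimpleModule.congr (LinearEquiv.ofInjective θ h).symm)
  · simp [h]

/-- In a semisimple module, nonzero elements are detected by projections to simple submodules. -/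
theorem IsSemisimpleModule.exists_simple_projection_ne_zero {M : Type*} [AddCommGroup M]
    [Module A M] [IsSemisimpleModule A M] {x : M} (hx : x ≠ 0) :
    ∃ (S : Submodule A M) (π : M →ₗ[A] S), IsSimpleModule A S ∧ π x ≠ 0 := by
  obtain h | ⟨S, hS, hs⟩ :=
    IsSemisimpleModule.eq_bot_or_exists_simple_le (R := A) (Submodule.span A {x})
  · exact absurd (Submodule.span_singleton_eq_bot.1 h) hx
  · obtain ⟨π, hπ⟩ := IsSemisimpleModule.extension_property S.subtype S.injective_subtype
      LinearMap.id
    refine ⟨S, π, hs, fun h0 => ?_⟩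
    have hle : S ≤ LinearMap.ker π :=
      hS.trans ((Submodule.span_singleton_le_iff_mem _ _).2 h0)
    have := hs.nontrivial
    obtain ⟨y, hy⟩ := exists_ne (0 : S)
    exact hy ((LinearMap.congr_fun hπ y).symm.trans (hle y.2))

/-- An internal decomposition of an indecomposable module is trivial. -/
theorem CategoryTheory.Indecomposable.eq_bot_or_eq_bot {Q : ModuleCat.{u} A} (hQ : Indecomposable Q)
    {N L : Submodule A Q} (h : IsCompl N L) : N = ⊥ ∨ L = ⊥ := by
  let e : Q ≅ ModuleCat.of A N ⊞ ModuleCat.of A L :=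
    (Submodule.prodEquivOfIsCompl N L h).symm.toModuleIso ≪≫
      (ModuleCat.biprodIsoProd (ModuleCat.of A N) (ModuleCat.of A L)).symm
  refine (hQ.2 _ _ e).imp (fun h => ?_) fun h => ?_ <;>
  · have := ModuleCat.subsingleton_of_isZero h
    exact (Submodule.subsingleton_iff_eq_bot).1 this

/-- Fitting's lemma: an endomorphism of an indecomposable module of finite length is nilpotent
or bijective. -/
theorem CategoryTheory.Indecomposable.bijective_or_isNilpotent {Q : ModuleCat.{u} A} (hQ : Indecomposable Q)
    [IsNoetherian A Q] [IsArtinian A Q] (e : Module.End A Q) :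
    Function.Bijective e ∨ IsNilpotent e := by
  -- The bound `1 ≤ k` lets injectivity of `e ^ k` descend to `e`.
  obtain ⟨k, hk, hk1⟩ := ((e.eventually_isCompl_ker_pow_range_pow).and
    (Filter.eventually_ge_atTop 1)).exists
  obtain h | h := hQ.eq_bot_or_eq_bot hk
  · left
    have hinj : Function.Injective (e ^ k) := LinearMap.ker_eq_bot.1 h
    have he : Function.Injective e := by
      obtain ⟨m, rfl⟩ := Nat.exists_eq_add_of_le' hk1
      rw [pow_succ] at hinj
      exact Function.Injective.of_comp (f := (e ^ m)) hinj
    exact IsArtinian.bijective_of_injective_endomorphism e he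
  · exact .inr ⟨k, LinearMap.range_eq_bot.1 h⟩

/-- If an indecomposable finite length projective module `Q` and a projective module `P` both map
nontrivially to a simple module, then `Q` is a direct summand of `P`. -/
theorem CategoryTheory.Indecomposable.isDirectSummand {Q P : ModuleCat.{u} A} (hQ : Indecomposable Q)
    [IsNoetherian A Q] [IsArtinian A Q] [Module.Projective A Q] [Module.Projective A P]
    {S : Type*} [AddCommGroup S] [Module A S] [IsSimpleModule A S] {π : Q →ₗ[A] S} (hπ : π ≠ 0)
    {ρ : P →ₗ[A] S} (hρ : ρ ≠ 0) : IsDirectSummand Q P := by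
  obtain ⟨i, hi⟩ := Module.projective_lifting_property ρ π (ρ.surjective_of_ne_zero hρ)
  obtain ⟨r, hr⟩ := Module.projective_lifting_property π ρ (π.surjective_of_ne_zero hπ)
  -- Since `r ∘ i` preserves the nonzero `π`, it cannot be nilpotent, so Fitting makes it bijective.
  have he : π ∘ₗ (r ∘ₗ i) = π := by rw [← LinearMap.comp_assoc, hr, hi]
  obtain hb | ⟨k, hk⟩ := hQ.bijective_or_isNilpotent (r ∘ₗ i)
  · let e := LinearEquiv.ofBijective (r ∘ₗ i) hb
    refine ⟨⟨ModuleCat.ofHom (i ∘ₗ e.symm.toLinearMap), ModuleCat.ofHom r, ?_⟩⟩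
    ext x
    exact e.apply_symm_apply x
  · have hpow (m : ℕ) : π ∘ₗ ((r ∘ₗ i) ^ m : Module.End A Q) = π := by
      induction m with
      | zero => rfl
      | succ m ih => rw [pow_succ, Module.End.mul_eq_comp, ← LinearMap.comp_assoc, ih, he]
    refine absurd ?_ hπ
    rw [← hpow k, hk, LinearMap.comp_zero]

theorem IsDirectSummand.finite {Q P : ModuleCat.{u} A} (h : IsDirectSummand Q P)
    [Module.Finite A P] : Module.Finite A Q := by
  obtain ⟨t⟩ := h
  exact Module.Finite.of_surjective t.r.hom fun x =>
    ⟨t.i x, congr($(t.retract) x)⟩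

theorem IsDirectSummand.projective {Q P : ModuleCat.{u} A} (h : IsDirectSummand Q P)
    [Module.Projective A P] : Module.Projective A Q := by
  obtain ⟨t⟩ := h
  exact Module.Projective.of_split t.i.hom t.r.hom congr(($(t.retract)).hom)

theorem IsDirectSummand.trans {Q P M : ModuleCat.{u} A} (h : IsDirectSummand Q P)
    (h' : IsDirectSummand P M) : IsDirectSummand Q M :=
  ⟨h.some.trans h'.some⟩

theorem isDirectSummand_biprod_left {M M₁ M₂ : ModuleCat.{u} A} (e : M ≅ M₁ ⊞ M₂) :
    IsDirectSummand M₁ M :=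
  ⟨⟨biprod.inl ≫ e.inv, e.hom ≫ biprod.fst, by simp⟩⟩

theorem isDirectSummand_biprod_right {M M₁ M₂ : ModuleCat.{u} A} (e : M ≅ M₁ ⊞ M₂) :
    IsDirectSummand M₂ M :=
  ⟨⟨biprod.inr ≫ e.inv, e.hom ≫ biprod.snd, by simp⟩⟩

/-- A projective cover of a finitely generated module is finitely generated. -/
theorem IsProjectiveCover.finite {P M : ModuleCat.{u} A} {p : P ⟶ M} (hp : IsProjectiveCover p)
    [Module.Finite A M] : Module.Finite A P := by
  obtain ⟨m, f, hf⟩ := Module.Finite.exists_fin' A M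
  obtain ⟨g, hg⟩ := Module.projective_lifting_property p.hom f hp.surjective
  refine Module.Finite.of_surjective g (LinearMap.range_eq_top.1 (hp.superfluous _ ?_))
  rw [eq_top_iff]
  intro x _
  obtain ⟨y, hy⟩ := hf (p x)
  refine Submodule.mem_sup.2 ⟨g y, ⟨y, rfl⟩, x - g y, ?_, by simp⟩
  have := LinearMap.congr_fun hg y
  simp only [LinearMap.comp_apply] at this
  rw [LinearMap.mem_ker, map_sub, this, hy]
  exact sub_self _

/-- A nonzero direct summand of a projective cover is not contained in the kernel. -/
theorem IsProjectiveCover.comp_ne_zero {P M Q : ModuleCat.{u} A} {p : P ⟶ M}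
    (hp : IsProjectiveCover p) (t : Retract Q P) (hQ : ¬ IsZero Q) : t.i ≫ p ≠ 0 := by
  intro h
  -- `P` is the sum of `ker r` and the image of `t.i`; the latter would lie in the superfluous `ker
  -- p`.
  have htop : LinearMap.ker t.r.hom = ⊤ := by
    refine hp.superfluous _ (eq_top_iff.2 fun x _ => ?_)
    have hx (y : Q) : t.r (t.i y) = y := congr($(t.retract) y)
    refine Submodule.mem_sup.2 ⟨x - t.i (t.r x), ?_, t.i (t.r x), congr($h (t.r x)), by simp⟩
    exact (map_sub t.r.hom _ _).trans (sub_eq_zero.2 (hx _).symm)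
  refine hQ ((IsZero.iff_id_eq_zero Q).2 ?_)
  rw [← t.retract, show t.r = 0 from ModuleCat.hom_ext (LinearMap.ker_eq_top.1 htop), comp_zero]

theorem InAdd.of_linearEquiv_pi {P M : ModuleCat.{u} A} {J : Type} [Fintype J]
    (Q : J → ModuleCat.{u} A) (hQ : ∀ j, IsDirectSummand (Q j) P) (e : M ≃ₗ[A] ∀ j, Q j) :
    InAdd P M := by
  let σ := (Fintype.equivFin J).symm
  exact ⟨Fintype.card J, fun k => Q (σ k), fun k => hQ _,
    ⟨(e ≪≫ₗ (LinearEquiv.piCongrLeft A (fun j => Q j) σ).symm).toModuleIso ≪≫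
      (ModuleCat.biproductIsoPi _).symm⟩⟩

theorem InAdd.of_iso_biprod {P M M₁ M₂ : ModuleCat.{u} A} (h₁ : InAdd P M₁) (h₂ : InAdd P M₂)
    (e : M ≅ M₁ ⊞ M₂) : InAdd P M := by
  obtain ⟨k₁, Q₁, hQ₁, ⟨e₁⟩⟩ := h₁
  obtain ⟨k₂, Q₂, hQ₂, ⟨e₂⟩⟩ := h₂
  refine InAdd.of_linearEquiv_pi (J := Fin k₁ ⊕ Fin k₂) (Sum.elim Q₁ Q₂) ?_
    ((e ≪≫ ModuleCat.biprodIsoProd M₁ M₂).toLinearEquiv ≪≫ₗ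
      LinearEquiv.prodCongr (e₁ ≪≫ ModuleCat.biproductIsoPi Q₁).toLinearEquiv
        (e₂ ≪≫ ModuleCat.biproductIsoPi Q₂).toLinearEquiv ≪≫ₗ
      (LinearEquiv.sumPiEquivProdPi A (Fin k₁) (Fin k₂)
        fun j => (Sum.elim Q₁ Q₂ j : ModuleCat.{u} A)).symm)
  rintro (j | j)
  exacts [hQ₁ j, hQ₂ j]

/-- A module of finite length is in `add P` if all its indecomposable direct summands are direct
summands of `P`. -/
theorem InAdd.of_indecomposable {P M : ModuleCat.{u} A} (hM : Module.length A M ≠ ⊤)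
    (h : ∀ Q : ModuleCat.{u} A, Indecomposable Q → IsDirectSummand Q M → IsDirectSummand Q P) :
    InAdd P M := by
  obtain ⟨k, hk⟩ := ENat.ne_top_iff_exists.1 hM
  clear hM
  induction k using Nat.strong_induction_on generalizing M with
  | _ k ih =>
  by_cases hz : IsZero M
  · have := ModuleCat.subsingleton_of_isZero hz
    exact InAdd.of_linearEquiv_pi (J := PEmpty) (fun j => j.elim) (fun j => j.elim)
      { toFun := 0, invFun := 0, map_add' := by simp, map_smul' := by simp
        left_inv := fun _ => Subsingleton.elim _ _
        right_inv := fun _ => Subsingleton.elim _ _ }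
  by_cases hi : Indecomposable M
  · exact InAdd.of_linearEquiv_pi (J := PUnit) (fun _ => M) (fun _ => h M hi ⟨Retract.refl M⟩)
      (LinearEquiv.funUnique PUnit A M).symm
  simp only [Indecomposable, hz, not_false_eq_true, true_and, not_forall, not_or] at hi
  obtain ⟨M₁, M₂, e, h₁, h₂⟩ := hi
  have hlen : Module.length A M = Module.length A M₁ + Module.length A M₂ := by
    rw [← Module.length_prod]
    exact (e ≪≫ ModuleCat.biprodIsoProd M₁ M₂).toLinearEquiv.length_eq
  have hp₁ : Module.length A M₁ ≠ 0 := fun hl => by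
    have := Module.length_eq_zero_iff.1 hl
    exact h₁ (ModuleCat.isZero_of_subsingleton M₁)
  have hp₂ : Module.length A M₂ ≠ 0 := fun hl => by
    have := Module.length_eq_zero_iff.1 hl
    exact h₂ (ModuleCat.isZero_of_subsingleton M₂)
  rw [← hk] at hlen
  have ht₁ : Module.length A M₁ ≠ ⊤ := fun ht => by simp [ht] at hlen
  have ht₂ : Module.length A M₂ ≠ ⊤ := fun ht => by simp [ht] at hlen
  obtain ⟨k₁, hk₁⟩ := ENat.ne_top_iff_exists.1 ht₁
  obtain ⟨k₂, hk₂⟩ := ENat.ne_top_iff_exists.1 ht₂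
  rw [← hk₁] at hlen hp₁
  rw [← hk₂] at hlen hp₂
  norm_cast at hlen hp₁ hp₂
  exact (ih k₁ (by omega) (fun Q hQ hs => h Q hQ (hs.trans (isDirectSummand_biprod_left e)))
    hk₁).of_iso_biprod
    (ih k₂ (by omega) (fun Q hQ hs => h Q hQ (hs.trans (isDirectSummand_biprod_right e))) hk₂) e

end Modules

/-! ### Replacing the term in degree 0 of a complex. -/

section Replacement

variable {A : Type u} [Ring A]

/-- The terms of a complex, with the one in degree `0` replaced by `Q`. -/
def replaceZeroX (C : CochainComplex (ModuleCat.{u} A) ℤ) (Q : ModuleCat.{u} A) :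
    ℤ → ModuleCat.{u} A
  | .ofNat 0 => Q
  | .ofNat (n + 1) => C.X (.ofNat (n + 1))
  | .negSucc n => C.X (.negSucc n)

/-- The differentials `Q ⟶ C¹ ⟶ C² ⟶ ⋯`, and zero in negative degrees. -/
def replaceZeroD (C : CochainComplex (ModuleCat.{u} A) ℤ) (Q : ModuleCat.{u} A) (q : Q ⟶ C.X 1) :
    ∀ i : ℤ, replaceZeroX C Q i ⟶ replaceZeroX C Q (i + 1)
  | .ofNat 0 => q
  | .ofNat (n + 1) => C.d (.ofNat (n + 1)) (.ofNat (n + 1 + 1))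
  | .negSucc _ => 0

/-- The complex `Q ⟶ C¹ ⟶ C² ⟶ ⋯` with `Q` in degree `0`. -/
def replaceZero (C : CochainComplex (ModuleCat.{u} A) ℤ) (Q : ModuleCat.{u} A) (q : Q ⟶ C.X 1)
    (hq : q ≫ C.d 1 2 = 0) : CochainComplex (ModuleCat.{u} A) ℤ :=
  CochainComplex.of (replaceZeroX C Q) (replaceZeroD C Q q) fun i =>
    match i with
    | .ofNat 0 => hq
    | .ofNat (_ + 1) => C.d_comp_d _ _ _
    | .negSucc _ => zero_comp

/-- Because the terms are defined by matching on constructors of `ℤ`, they reduce definitionally and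
no transport along equalities of degrees is needed. -/
theorem replaceZero_d_zero (C : CochainComplex (ModuleCat.{u} A) ℤ) (Q : ModuleCat.{u} A)
    (q : Q ⟶ C.X 1) (hq : q ≫ C.d 1 2 = 0) : (replaceZero C Q q hq).d 0 1 = q :=
  CochainComplex.of_d (replaceZeroX C Q) (replaceZeroD C Q q) 0

theorem replaceZero_d_succ (C : CochainComplex (ModuleCat.{u} A) ℤ) (Q : ModuleCat.{u} A)
    (q : Q ⟶ C.X 1) (hq : q ≫ C.d 1 2 = 0) (n : ℕ) :
    (replaceZero C Q q hq).d (.ofNat (n + 1)) (.ofNat (n + 1 + 1)) =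
      C.d (.ofNat (n + 1)) (.ofNat (n + 1 + 1)) :=
  CochainComplex.of_d (replaceZeroX C Q) (replaceZeroD C Q q) (.ofNat (n + 1))

theorem isBoundedProj_replaceZero {b : ℕ} {C : CochainComplex (ModuleCat.{u} A) ℤ}
    (hC : IsBoundedProj A 0 b C) (Q : ModuleCat.{u} A) [Module.Finite A Q] [Module.Projective A Q]
    (q : Q ⟶ C.X 1) (hq : q ≫ C.d 1 2 = 0) : IsBoundedProj A 0 b (replaceZero C Q q hq) := by
  refine ⟨fun i => ?_, fun i hi => ?_⟩
  · match i with
    | .ofNat 0 => exact ⟨‹Module.Finite A Q›, ‹Module.Projective A Q›⟩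
    | .ofNat (n + 1) => exact hC.1 (.ofNat (n + 1))
    | .negSucc n => exact hC.1 (.negSucc n)
  · match i with
    | .ofNat 0 => exact absurd ⟨le_rfl, Int.natCast_nonneg b⟩ hi
    | .ofNat (n + 1) => exact hC.2 (.ofNat (n + 1)) hi
    | .negSucc n => exact hC.2 (.negSucc n) hi

/-- A chain map between complexes, the first of which vanishes in negative degrees, given by its
component in degree `0` and those in positive degrees. -/
def homOfNat {D E : CochainComplex (ModuleCat.{u} A) ℤ} (hD : ∀ n : ℕ, IsZero (D.X (.negSucc n)))
    (α₀ : D.X 0 ⟶ E.X 0) (α : ∀ n : ℕ, D.X (.ofNat (n + 1)) ⟶ E.X (.ofNat (n + 1)))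
    (h₀ : α₀ ≫ E.d 0 1 = D.d 0 1 ≫ α 0)
    (h : ∀ n, α n ≫ E.d (.ofNat (n + 1)) (.ofNat (n + 1 + 1)) =
      D.d (.ofNat (n + 1)) (.ofNat (n + 1 + 1)) ≫ α (n + 1)) : D ⟶ E :=
  CochainComplex.ofHom
    (fun i => match i with
      | .ofNat 0 => α₀
      | .ofNat (n + 1) => α n
      | .negSucc _ => 0)
    (fun i => match i with
      | .ofNat 0 => h₀
      | .ofNat (n + 1) => h n
      | .negSucc n => (hD n).eq_of_src _ _)

theorem hom_ext_of_nat {D E : CochainComplex (ModuleCat.{u} A) ℤ}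
    (hD : ∀ n : ℕ, IsZero (D.X (.negSucc n))) {f g : D ⟶ E} (h₀ : f.f 0 = g.f 0)
    (h : ∀ n : ℕ, f.f (.ofNat (n + 1)) = g.f (.ofNat (n + 1))) : f = g := by
  ext1 i
  match i with
  | .ofNat 0 => exact h₀
  | .ofNat (n + 1) => exact h n
  | .negSucc n => exact (hD n).eq_of_src _ _

theorem IsBoundedProj.isZero_negSucc {b : ℤ} {D : CochainComplex (ModuleCat.{u} A) ℤ}
    (hD : IsBoundedProj A 0 b D) (n : ℕ) : IsZero (D.X (.negSucc n)) :=
  hD.2 _ fun h => absurd h.1 (by omega)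

theorem isZero_X_zero {n : ℕ} (X : BoundedProjComplex A 1 n) : IsZero (X.obj.X 0) :=
  X.property.2 0 fun h => absurd h.1 (by omega)

/-- A morphism `f : X ⟶ Z` with `X⁰ = 0` is a section as soon as it has a retraction in positive
degrees that kills the differential `Z⁰ ⟶ Z¹`. -/
theorem isSplitMono_of_retraction {n : ℕ} {X Z : BoundedProjComplex A 0 n}
    (hX : IsZero (X.obj.X 0)) (f : X ⟶ Z)
    (ρ : ∀ m : ℕ, Z.obj.X (.ofNat (m + 1)) ⟶ X.obj.X (.ofNat (m + 1)))
    (hρ : ∀ m, ρ m ≫ X.obj.d (.ofNat (m + 1)) (.ofNat (m + 1 + 1)) =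
      Z.obj.d (.ofNat (m + 1)) (.ofNat (m + 1 + 1)) ≫ ρ (m + 1))
    (hfρ : ∀ m, f.hom.f (.ofNat (m + 1)) ≫ ρ m = 𝟙 _) (h₀ : Z.obj.d 0 1 ≫ ρ 0 = 0) :
    IsSplitMono f := by
  refine ⟨⟨⟨ObjectProperty.homMk
    (homOfNat Z.property.isZero_negSucc 0 ρ (by rw [h₀, zero_comp]) hρ), ?_⟩⟩⟩
  ext1
  exact hom_ext_of_nat X.property.isZero_negSucc (hX.eq_of_src _ _) fun m => hfρ m

/-- A left almost split morphism `X ⟶ Z` with `X⁰ = 0` does not allow any nonzero `q : Q ⟶ X¹`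
with `d q = 0` to be killed: `q` composes nontrivially with some map `Z⁰ ⟶ Q`. -/
theorem IsLeftAlmostSplit.exists_comp_ne_zero {n : ℕ} {X Z : BoundedProjComplex A 0 n}
    (hX : IsZero (X.obj.X 0)) {f : X ⟶ Z} (hf : IsLeftAlmostSplit f)
    (Q : ModuleCat.{u} A) [Module.Finite A Q] [Module.Projective A Q] (q : Q ⟶ X.obj.X 1)
    (hq : q ≫ X.obj.d 1 2 = 0) (hq0 : q ≠ 0) : ∃ h : Z.obj.X 0 ⟶ Q, h ≫ q ≠ 0 := by
  let W : BoundedProjComplex A 0 n :=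
    ⟨replaceZero X.obj Q q hq, isBoundedProj_replaceZero X.property Q q hq⟩
  have hd : W.obj.d 0 1 = q := replaceZero_d_zero X.obj Q q hq
  have hd' (m : ℕ) : W.obj.d (.ofNat (m + 1)) (.ofNat (m + 1 + 1)) =
      X.obj.d (.ofNat (m + 1)) (.ofNat (m + 1 + 1)) := replaceZero_d_succ X.obj Q q hq m
  let c : X ⟶ W := ObjectProperty.homMk (homOfNat (E := W.obj) X.property.isZero_negSucc
    (hX.to_ _) (fun m => 𝟙 (X.obj.X (.ofNat (m + 1)))) (hX.eq_of_src _ _)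
    (fun m => (Category.id_comp _).trans ((hd' m).trans (Category.comp_id _).symm)))
  have hc (m : ℕ) : c.hom.f (.ofNat (m + 1)) = 𝟙 (X.obj.X (.ofNat (m + 1))) := rfl
  -- A retraction would be `0` in degree 0 and the identity in degree 1, so commuting with the
  -- differentials would force `q = 0`.
  have hcs : ¬ IsSplitMono c := by
    rintro ⟨⟨r, hr⟩⟩
    have h1 : (𝟙 (X.obj.X 1)) ≫ r.hom.f 1 = 𝟙 (X.obj.X 1) :=
      congr(($hr).hom.f 1)
    have h2 : r.hom.f 0 ≫ X.obj.d 0 1 = W.obj.d 0 1 ≫ r.hom.f 1 := r.hom.comm 0 1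
    rw [hX.eq_of_tgt (r.hom.f 0) 0, zero_comp, hd] at h2
    have h3 : r.hom.f 1 = 𝟙 (X.obj.X 1) := (Category.id_comp _).symm.trans h1
    rw [h3] at h2
    exact hq0 ((Category.comp_id q).symm.trans h2.symm)
  obtain ⟨h, hh⟩ := hf.2 c hcs
  refine ⟨h.hom.f 0, fun h0 => hf.1 ?_⟩
  refine isSplitMono_of_retraction hX f (fun m => h.hom.f (.ofNat (m + 1))) (fun m => ?_)
    (fun m => ?_) ?_
  · refine Eq.trans ?_ (h.hom.comm (.ofNat (m + 1)) (.ofNat (m + 1 + 1)))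
    rw [hd']
    rfl
  · exact congr(($hh).hom.f (.ofNat (m + 1)))
  · refine (h.hom.comm 0 1).symm.trans ?_
    rw [hd]
    exact h0

end Replacement

/-! ### The last term of an almost split sequence. -/

section AlmostSplitSequences

variable {A : Type u} [Ring A]

theorem IsConflation.shortExact_eval {a b : ℤ} {S : ShortComplex (BoundedProjComplex A a b)}
    (hS : IsConflation S) (i : ℤ) :
    ((S.map (IsBoundedProj A a b).ι).map
      (HomologicalComplex.eval (ModuleCat.{u} A) (ComplexShape.up ℤ) i)).ShortExact :=
  ShortComplex.ShortExact.map_of_exact hS _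

/-- In an almost split sequence `0 ⟶ X ⟶ E ⟶ Y ⟶ 0` with `X⁰ = 0`, every `ν : V ⟶ Y⁰` that is not
a retraction is annihilated by some nonzero map from `Y⁰` to the kernel of `X¹ ⟶ X²`. -/
theorem IsAlmostSplitSequence.exists_ne_zero_comp_eq_zero {n : ℕ}
    {S : ShortComplex (BoundedProjComplex A 0 n)} (hS : IsAlmostSplitSequence S)
    (hX : IsZero (S.X₁.obj.X 0)) (V : ModuleCat.{u} A) [Module.Finite A V] [Module.Projective A V]
    (ν : V ⟶ S.X₃.obj.X 0) (hν : ¬ IsSplitEpi ν) :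
    ∃ φ : S.X₃.obj.X 0 ⟶ S.X₁.obj.X 1, φ ≠ 0 ∧ ν ≫ φ = 0 ∧ φ ≫ S.X₁.obj.d 1 2 = 0 := by
  have hq : (ν ≫ S.X₃.obj.d 0 1) ≫ S.X₃.obj.d 1 2 = 0 := by simp
  let W : BoundedProjComplex A 0 n :=
    ⟨replaceZero S.X₃.obj V _ hq, isBoundedProj_replaceZero S.X₃.property V _ hq⟩
  have hd : W.obj.d 0 1 = ν ≫ S.X₃.obj.d 0 1 := replaceZero_d_zero S.X₃.obj V _ hq
  have hd' (m : ℕ) : W.obj.d (.ofNat (m + 1)) (.ofNat (m + 1 + 1)) =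
      S.X₃.obj.d (.ofNat (m + 1)) (.ofNat (m + 1 + 1)) := replaceZero_d_succ S.X₃.obj V _ hq m
  let c : W ⟶ S.X₃ := ObjectProperty.homMk (homOfNat (D := W.obj) W.property.isZero_negSucc
    ν (fun m => 𝟙 (S.X₃.obj.X (.ofNat (m + 1)))) (hd.symm.trans (Category.comp_id _).symm)
    (fun m => (Category.id_comp _).trans ((hd' m).symm.trans (Category.comp_id _).symm)))
  have hc : ¬ IsSplitEpi c := by
    rintro ⟨⟨s, hs⟩⟩
    exact hν ⟨⟨s.hom.f 0, congr(($hs).hom.f 0)⟩⟩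
  obtain ⟨l, hl⟩ := hS.right.2 c hc
  let l₀ : V ⟶ S.X₂.obj.X 0 := l.hom.f 0
  have hl₀ : l₀ ≫ S.g.hom.f 0 = ν := congr(($hl).hom.f 0)
  let w (m : ℕ) : S.X₃.obj.X (.ofNat (m + 1)) ⟶ S.X₂.obj.X (.ofNat (m + 1)) :=
    l.hom.f (.ofNat (m + 1))
  have hwg (m : ℕ) : w m ≫ S.g.hom.f (.ofNat (m + 1)) = 𝟙 _ :=
    congr(($hl).hom.f (.ofNat (m + 1)))
  have hwd (m : ℕ) : w m ≫ S.X₂.obj.d (.ofNat (m + 1)) (.ofNat (m + 1 + 1)) =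
      S.X₃.obj.d (.ofNat (m + 1)) (.ofNat (m + 1 + 1)) ≫ w (m + 1) := by
    rw [← hd']
    exact l.hom.comm (.ofNat (m + 1)) (.ofNat (m + 1 + 1))
  let w₁ : S.X₃.obj.X 1 ⟶ S.X₂.obj.X 1 := w 0
  have hw₁ : l₀ ≫ S.X₂.obj.d 0 1 = (ν ≫ S.X₃.obj.d 0 1) ≫ w₁ := by
    refine (l.hom.comm 0 1).trans ?_
    rw [hd]
    rfl
  have hfg (i : ℤ) : S.f.hom.f i ≫ S.g.hom.f i = 0 := congr(($(S.zero)).hom.f i)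
  have hmono (i : ℤ) : Mono (S.f.hom.f i) := (hS.conflation.shortExact_eval i).mono_f
  -- `w` is a section of `g` in positive degrees, so `1 - g ≫ w` lands in the kernel of `g`; `ρ` is
  -- the complementary retraction of `f`.
  have hρ (m : ℕ) : ∃ ρ : S.X₂.obj.X (.ofNat (m + 1)) ⟶ S.X₁.obj.X (.ofNat (m + 1)),
      ρ ≫ S.f.hom.f (.ofNat (m + 1)) = 𝟙 _ - S.g.hom.f (.ofNat (m + 1)) ≫ w m := by
    have he := hS.conflation.shortExact_eval (.ofNat (m + 1))
    have := he.mono_f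
    refine ⟨he.exact.lift (𝟙 _ - S.g.hom.f (.ofNat (m + 1)) ≫ w m) ?_, he.exact.lift_f _ _⟩
    change (𝟙 _ - S.g.hom.f (.ofNat (m + 1)) ≫ w m) ≫ S.g.hom.f (.ofNat (m + 1)) = 0
    rw [Preadditive.sub_comp, Category.id_comp, Category.assoc, hwg, Category.comp_id, sub_self]
  choose ρ hρ using hρ
  have hfρ (m : ℕ) : S.f.hom.f (.ofNat (m + 1)) ≫ ρ m = 𝟙 _ := by
    rw [← cancel_mono (S.f.hom.f (.ofNat (m + 1))), Category.assoc, hρ, Preadditive.comp_sub,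
      ← Category.assoc, hfg, zero_comp, sub_zero, Category.comp_id, Category.id_comp]
  have hwρ (m : ℕ) : w m ≫ ρ m = 0 := by
    rw [← cancel_mono (S.f.hom.f (.ofNat (m + 1))), Category.assoc, hρ, Preadditive.comp_sub,
      ← Category.assoc, hwg, Category.id_comp, Category.comp_id, sub_self, zero_comp]
  have hρd (m : ℕ) : ρ m ≫ S.X₁.obj.d (.ofNat (m + 1)) (.ofNat (m + 1 + 1)) =
      S.X₂.obj.d (.ofNat (m + 1)) (.ofNat (m + 1 + 1)) ≫ ρ (m + 1) := by
    rw [← cancel_mono (S.f.hom.f (.ofNat (m + 1 + 1))), Category.assoc, Category.assoc, hρ,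
      ← S.f.hom.comm, ← Category.assoc, hρ, Preadditive.sub_comp, Preadditive.comp_sub,
      Category.assoc, hwd, ← Category.assoc, S.g.hom.comm, Category.id_comp, Category.comp_id,
      Category.assoc]
  have hiso : IsIso (S.g.hom.f 0) := by
    have he := hS.conflation.shortExact_eval 0
    have h1 : Epi (S.g.hom.f 0) := he.epi_g
    have h2 : Mono (S.g.hom.f 0) := he.exact.mono_g (hX.eq_of_src _ _)
    exact isIso_of_mono_of_epi _
  let ρ₁ : S.X₂.obj.X 1 ⟶ S.X₁.obj.X 1 := ρ 0
  have hwρ₁ : w₁ ≫ ρ₁ = 0 := hwρ 0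
  have hρd₁ : ρ₁ ≫ S.X₁.obj.d 1 2 = S.X₂.obj.d 1 2 ≫ ρ 1 := hρd 0
  -- This is `Y⁰ ≅ E⁰ ⟶ E¹ ⟶ X¹`. Were it zero, `ρ` would extend by zero to a retraction of `f`. It
  -- kills `ν` because `l` turns `ν` into a map through `w₁`, and `w₁ ≫ ρ₁ = 0`.
  refine ⟨inv (S.g.hom.f 0) ≫ S.X₂.obj.d 0 1 ≫ ρ₁, fun h0 => hS.left.1 ?_, ?_, ?_⟩
  · exact isSplitMono_of_retraction hX S.f ρ hρd hfρ
      ((IsIso.inv_comp_eq _).1 h0 |>.trans comp_zero)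
  · have hν' : ν ≫ inv (S.g.hom.f 0) = l₀ := (IsIso.comp_inv_eq _).2 hl₀.symm
    rw [← Category.assoc, hν', ← Category.assoc, hw₁, Category.assoc, hwρ₁, comp_zero]
  · rw [Category.assoc, Category.assoc, hρd₁, S.X₂.obj.d_comp_d_assoc, zero_comp, comp_zero]

/-- If every maximal submodule of `M` is annihilated by a nonzero map to `K`, then each
indecomposable summand of `M` is a summand of the projective cover of the socle of `K`. -/
theorem isDirectSummand_projectiveCover_socle [IsArtinianRing A] {M P Q : ModuleCat.{u} A}
    {K : Type u} [AddCommGroup K] [Module A K] [Module.Finite A M] [Module.Projective A M]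
    {p : P ⟶ ModuleCat.of A (moduleSocle A K)} (hp : IsProjectiveCover p)
    (h : ∀ N : Submodule A M, N ≠ ⊤ → ∃ φ : M →ₗ[A] K, φ ≠ 0 ∧ N ≤ LinearMap.ker φ)
    (hQ : Indecomposable Q) (hQM : IsDirectSummand Q M) : IsDirectSummand Q P := by
  have := hQM.finite
  have := hQM.projective
  have := hp.projective
  obtain ⟨t⟩ := hQM
  have hr : Function.Surjective t.r.hom := fun x => ⟨t.i x, congr($(t.retract) x)⟩
  have hnt : Nontrivial Q := by
    by_contra hs
    rw [not_nontrivial_iff_subsingleton] at hs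
    exact hQ.1 (ModuleCat.isZero_of_subsingleton Q)
  obtain ⟨N, hN, -⟩ := (eq_top_or_exists_le_coatom (⊥ : Submodule A Q)).resolve_left bot_ne_top
  have := isSimpleModule_iff_isCoatom.2 hN
  let π : M →ₗ[A] Q ⧸ N := N.mkQ ∘ₗ t.r.hom
  have hπ : Function.Surjective π := N.mkQ_surjective.comp hr
  have hnz : Nontrivial (Q ⧸ N) := IsSimpleModule.nontrivial A _
  -- `φ` vanishes on `ker π`, so it induces a nonzero map from the simple module `Q ⧸ N` to `K`,
  -- with image in the socle.
  obtain ⟨φ, hφ, hker⟩ := h (LinearMap.ker π) fun htop => by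
    obtain ⟨y, hy⟩ := exists_ne (0 : Q ⧸ N)
    obtain ⟨x, rfl⟩ := hπ y
    exact hy (LinearMap.congr_fun (LinearMap.ker_eq_top.1 htop) x)
  let θ : (Q ⧸ N) →ₗ[A] K :=
    (LinearMap.ker π).liftQ φ hker ∘ₗ (π.quotKerEquivOfSurjective hπ).symm.toLinearMap
  have hθ (x : M) : θ (π x) = φ x := by
    have : (π.quotKerEquivOfSurjective hπ).symm (π x) = Submodule.Quotient.mk x := by
      rw [LinearEquiv.symm_apply_eq]; rfl
    simp [θ, this]
  have hθ0 : θ ≠ 0 := fun h0 => hφ (LinearMap.ext fun x => by rw [← hθ, h0]; rfl)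
  let θ' : (Q ⧸ N) →ₗ[A] moduleSocle A K :=
    θ.codRestrict _ fun x => range_le_moduleSocle θ ⟨x, rfl⟩
  have hinj : Function.Injective θ' := by
    refine (θ'.injective_or_eq_zero).resolve_right fun h0 => hθ0 (LinearMap.ext fun x => ?_)
    exact congr((($h0) x : K))
  -- The socle is semisimple, so `Q ⧸ N` splits off it and `P` maps onto `Q ⧸ N`.
  obtain ⟨σ, hσ⟩ := IsSemisimpleModule.extension_property θ' hinj LinearMap.id
  have hσ' : Function.Surjective σ := fun y => ⟨θ' y, LinearMap.congr_fun hσ y⟩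
  refine hQ.isDirectSummand (π := N.mkQ) (ρ := σ ∘ₗ p.hom) (fun h0 => ?_) fun h0 => ?_
  · obtain ⟨y, hy⟩ := exists_ne (0 : Q ⧸ N)
    obtain ⟨x, rfl⟩ := N.mkQ_surjective y
    exact hy (LinearMap.congr_fun h0 x)
  · obtain ⟨y, hy⟩ := exists_ne (0 : Q ⧸ N)
    obtain ⟨x, rfl⟩ := hσ'.comp hp.surjective y
    exact hy (LinearMap.congr_fun h0 x)

end AlmostSplitSequences

/-! ### The two statements. -/

theorem mainTheorem5 {R : Type v} [CommRing R] [IsArtinianRing R]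
    {A : Type u} [Ring A] [Algebra R A] [Module.Finite R A]
    (n : ℕ) (hn : 1 ≤ n)
    (X : BoundedProjComplex A 1 n) (hX : Indecomposable X)
    (P : ModuleCat.{u} A) (p : P ⟶ socKerOne X) (hp : IsProjectiveCover p) :
    (∀ (Z : BoundedProjComplex A 0 n) (f : (inclZero A n).obj X ⟶ Z), IsLeftAlmostSplit f →
      ∀ Q : ModuleCat.{u} A, Indecomposable Q → IsDirectSummand Q P →
        IsDirectSummand Q (Z.obj.X 0)) ∧
    (¬ IsInjectiveComplex ((inclZero A n).obj X) →
      ∀ Y : BoundedProjComplex A 0 n, IsInverseTranslate ((inclZero A n).obj X) Y →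
        InAdd P (Y.obj.X 0)) := by
  have hA : IsArtinianRing A := IsArtinianRing.of_finite R A
  let K := LinearMap.ker (X.obj.d 1 2).hom
  have hX1 : Module.Finite A (X.obj.X 1) := (X.property.1 1).1
  have hPfin : Module.Finite A P := hp.finite
  have hPproj := hp.projective
  refine ⟨fun Z f hf Q hQ hQP => ?_, fun _ Y hY => ?_⟩
  · have := hQP.finite
    have := hQP.projective
    have := (Z.property.1 0).2
    obtain ⟨t⟩ := hQP
    have hne := hp.comp_ne_zero t hQ.1
    obtain ⟨x, hx⟩ : ∃ x : Q, p (t.i x) ≠ 0 := by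
      by_contra! hall
      exact hne (ModuleCat.hom_ext (LinearMap.ext hall))
    obtain ⟨S, π, hS, hπ⟩ := IsSemisimpleModule.exists_simple_projection_ne_zero (A := A) hx
    let π' : Q →ₗ[A] S := π ∘ₗ p.hom ∘ₗ t.i.hom
    let ι : S →ₗ[A] X.obj.X 1 := K.subtype ∘ₗ (moduleSocle A K).subtype ∘ₗ S.subtype
    have hι : Function.Injective ι :=
      K.injective_subtype.comp ((moduleSocle A K).injective_subtype.comp S.injective_subtype)
    have hπ' : π' ≠ 0 := fun h0 => hπ (LinearMap.congr_fun h0 x)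
    obtain ⟨h, hh⟩ := hf.exists_comp_ne_zero (isZero_X_zero X) Q (ModuleCat.ofHom (ι ∘ₗ π'))
      (by ext y; exact ((π' y : moduleSocle A K) : K).2)
      (fun h0 => hπ' (LinearMap.ext fun y => hι (congr($h0 y).trans (map_zero ι).symm)))
    refine hQ.isDirectSummand (S := S) hπ' (ρ := π' ∘ₗ h.hom) fun h0 => hh ?_
    ext y
    exact (congrArg ι (LinearMap.congr_fun h0 y)).trans (map_zero ι)
  · obtain ⟨E, f, g, hfg, hS⟩ := hY
    have hfin := (Y.property.1 0).1
    have := (Y.property.1 0).2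
    refine InAdd.of_indecomposable Module.length_ne_top fun Q hQ hQY =>
      isDirectSummand_projectiveCover_socle hp (fun N hN => ?_) hQ hQY
    -- `N` need not be projective, so a finite free module covering it serves as the new degree 0
    -- term.
    obtain ⟨k, s, hs⟩ := Module.Finite.exists_fin' A N
    let ν : ModuleCat.of A (Fin k → A) ⟶ Y.obj.X 0 := ModuleCat.ofHom (N.subtype ∘ₗ s)
    have hν : ¬ IsSplitEpi ν := by
      rintro ⟨⟨σ, hσ⟩⟩
      refine hN (eq_top_iff.2 fun y _ => ?_)
      have hy : N.subtype (s (σ y)) = y := congr($hσ y)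
      rw [← hy]
      exact (s (σ y)).2
    obtain ⟨φ, hφ, hνφ, hφd⟩ := hS.exists_ne_zero_comp_eq_zero (isZero_X_zero X) _ ν hν
    refine ⟨φ.hom.codRestrict K fun y => congr($hφd y), fun h0 => hφ ?_, fun y hy => ?_⟩
    · ext y
      exact congr((($h0) y : X.obj.X 1))
    · obtain ⟨z, hz⟩ := hs ⟨y, hy⟩
      have hzy : N.subtype (s z) = y := by rw [hz]; rfl
      refine Subtype.ext ?_
      rw [← hzy]
      exact congr($hνφ z)
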